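/- A deterministic two-user multiple-access channel (MAC) is a function $g\colon\mathcal X\times\mathcal X\to\mathcal Y$ with finite alphabets $|\mathcal X|=X$, $|\mathcal Y|=Y$; used $n$ times it maps $(x_1,x_2)\in\mathcal X^n\times\mathcal X^n$ to $y\in\mathcal Y^n$ with $y[i]=g(x_1[i],x_2[i])$. For a domain $\mathcal U$ with $|\mathcal U|=U$ and a range $\mathcal W$ with $|\mathcal W|=W$, let $\mathcal A(U,W)$ be the set of all target functions $a\colon\mathcal U\times\mathcal U\to\mathcal W$. A target function $a$ is $\delta$-feasible over $n$ uses of $g$ if there are encoders $f_1,f_2\colon\mathcal U\to\mathcal X^n$ and a decoder $\phi\colon\mathcal Y^n\to\mathcal W$ such that, for independent messages $u_1,u_2$ uniformly distributed on $\mathcal U$, the decoder's output on the channel output for inputs $f_1(u_1),f_2(u_2)$ differs from $a(u_1,u_2)$ with probability at most $\delta$. **Theorem.** Fix a deterministic MAC $g$ (so $X$ and $Y$ are constant). Let $W(U)$, $n(U)$ be sequences of natural numbers and $\delta(U)$ a sequence of reals such that $W(U)\to\infty$ as $U\to\infty$ and, for all large $U$, $W(U)\le U^2$ and $0<\delta(U)\le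 1/(2\ln W(U))$. Suppose that the fraction of target functions $a\in\mathcal A(U,W(U))$ that are $\delta(U)$-feasible over $n(U)$ uses of $g$ is bounded below by a positive constant for all large $U$ (for instance, that it has a positive limit as $U\to\infty$). Then there is a joint distribution of the form $p(q)\,p(x_1|q)\,p(x_2|q)\,p(y|x_1,x_2)$, independent of $U$, with $q$ in a finite set, $x_1,x_2\in\mathcal X$ and $p(y|x_1,x_2)$ given by $y=g(x_1,x_2)$, such that $$\liminf_{U\to\infty}\frac{n(U)\,H(y|q)}{\log_2 U}\ge 2,\qquad \liminf_{U\to\infty}\frac{n(U)\,H(y|x_1,q)}{\log_2 U}\ge 1,\qquad \liminf_{U\to\infty}\frac{n(U)\,H(y|x_2,q)}{\log_2 U}\ge 1,$$ where $H(\cdot|\cdot)$ is conditional entropy in bits. In other words, $U^2\mathrel{\dot\le}2^{n(U)H(y|q)}$, $U\mathrel{\dot\le}2^{n(U)H(y|x_1,q)}$ and $U\mathrel{\dot\le}2^{n(U)H(y|x_2,q)}$. -/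

import Mathlib

open Filter

namespace MACComputation

/-- Target functions `a : 𝒰 × 𝒰 → 𝒲` with `|𝒰| = U` and `|𝒲| = W`. -/
abbrev TargetFunction (U W : ℕ) : Type := Fin U → Fin U → Fin W

/-- Deterministic two-user multiple-access channels `g : 𝒳 × 𝒳 → 𝒴` with `|𝒳| = X`, `|𝒴| = Y`. -/
abbrev Channel (X Y : ℕ) : Type := Fin X → Fin X → Fin Y

/-- `n` memoryless uses of the channel `g`, as one channel on input and output words of length `n`. -/
def Channel.power {X Y : ℕ} (g : Channel X Y) (n : ℕ) :
    (Fin n → Fin X) → (Fin n → Fin X) → (Fin n → Fin Y) :=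
  fun x₁ x₂ i => g (x₁ i) (x₂ i)

/-- The probability that the decoder output differs from the target value, for independent messages
that are uniformly distributed on `U₁` and `U₂`. -/
noncomputable def errorProb {U₁ U₂ X₁ X₂ Y W : Type} [Fintype U₁] [Fintype U₂] [DecidableEq W]
    (a : U₁ → U₂ → W) (g : X₁ → X₂ → Y) (f₁ : U₁ → X₁) (f₂ : U₂ → X₂) (φ : Y → W) : ℝ :=
  ((Finset.univ.filter
      fun u : U₁ × U₂ => a u.1 u.2 ≠ φ (g (f₁ u.1) (f₂ u.2))).card : ℝ) /
    ((Fintype.card U₁ : ℝ) * (Fintype.card U₂ : ℝ))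

/-- The pair `(a, g)` is `δ`-feasible: there are encoders `f₁`, `f₂` and a decoder `φ` that compute
`a` over `g` with probability of error at most `δ`. -/
def Feasible {U₁ U₂ X₁ X₂ Y W : Type} [Fintype U₁] [Fintype U₂] [DecidableEq W]
    (δ : ℝ) (a : U₁ → U₂ → W) (g : X₁ → X₂ → Y) : Prop :=
  ∃ (f₁ : U₁ → X₁) (f₂ : U₂ → X₂) (φ : Y → W), errorProb a g f₁ f₂ φ ≤ δ

/-- The fraction of all target functions in `𝒜(U, W)` that are `δ`-feasible over `n` uses of `g`. -/
noncomputable def feasibleFraction {X Y : ℕ} (g : Channel X Y) (n U W : ℕ) (δ : ℝ) : ℝ :=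
  (Nat.card {a : TargetFunction U W // Feasible δ a (g.power n)} : ℝ) /
    (Nat.card (TargetFunction U W) : ℝ)

/-- The mass that `p` gives to the event `E`. -/
def prob {Ω : Type} [Fintype Ω] (p : Ω → ℝ) (E : Ω → Prop) [DecidablePred E] : ℝ :=
  ∑ ω ∈ Finset.univ.filter E, p ω

/-- The conditional entropy in bits, `H(A | B) = ∑ b, P(B = b) H(A | B = b)`, of two random variables
on a finite space with probability mass function `p`. -/
noncomputable def condEntropy {Ω α β : Type} [Fintype Ω] [Fintype α] [Fintype β]
    [DecidableEq α] [DecidableEq β] (p : Ω → ℝ) (A : Ω → α) (B : Ω → β) : ℝ :=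
  ∑ b, prob p (fun ω => B ω = b) *
    ∑ a, Real.negMulLog
      (prob p (fun ω => A ω = a ∧ B ω = b) / prob p (fun ω => B ω = b)) / Real.log 2

/-- A distribution of the form `p(q) p(x₁ | q) p(x₂ | q)`, with `q` in a finite set and `x₁`, `x₂`
in the channel input alphabet of size `X`. -/
structure InputDistribution (X : ℕ) where
  /-- the number of values of `q` -/
  Q : ℕ
  /-- `p(q)` -/
  pQ : Fin Q → ℝ
  /-- `p(x₁ | q)` -/
  p₁ : Fin Q → Fin X → ℝ
  /-- `p(x₂ | q)` -/
  p₂ : Fin Q → Fin X → ℝ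
  pQ_mem : pQ ∈ stdSimplex ℝ (Fin Q)
  p₁_mem : ∀ q, p₁ q ∈ stdSimplex ℝ (Fin X)
  p₂_mem : ∀ q, p₂ q ∈ stdSimplex ℝ (Fin X)

namespace InputDistribution

variable {X Y : ℕ}

/-- The joint probability mass function of `(q, x₁, x₂)`. Given these, the output of a deterministic
channel `g` is `y = g x₁ x₂`. -/
def joint (P : InputDistribution X) : Fin P.Q × Fin X × Fin X → ℝ :=
  fun ω => P.pQ ω.1 * P.p₁ ω.1 ω.2.1 * P.p₂ ω.1 ω.2.2

/-- `H(y | q)` -/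
noncomputable def entropyGivenQ (P : InputDistribution X) (g : Channel X Y) : ℝ :=
  condEntropy P.joint (fun ω => g ω.2.1 ω.2.2) (fun ω => ω.1)

/-- `H(y | x₁, q)` -/
noncomputable def entropyGivenX₁Q (P : InputDistribution X) (g : Channel X Y) : ℝ :=
  condEntropy P.joint (fun ω => g ω.2.1 ω.2.2) (fun ω => (ω.2.1, ω.1))

/-- `H(y | x₂, q)` -/
noncomputable def entropyGivenX₂Q (P : InputDistribution X) (g : Channel X Y) : ℝ :=
  condEntropy P.joint (fun ω => g ω.2.1 ω.2.2) (fun ω => (ω.2.2, ω.1))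

end InputDistribution

/-- The relation that `U ^ a` is at most `f U` to first order in the exponent, as `U → ∞`:
`liminf log (f U) / log U ≥ a`. The lower limit is taken in the extended reals. -/
def PowDotLe (a : ℝ) (f : ℕ → ℝ) : Prop :=
  (a : EReal) ≤ liminf (fun U : ℕ => ((Real.log (f U) / Real.log (U : ℝ) : ℝ) : EReal)) atTop

end MACComputation

/-! The argument is a count followed by a single-letter entropy bound. A feasible target function
lies within Hamming distance `δ U²` of a decoder composed with the channel output. If every pair of
encoders yields at most `M` outputs, there are at most `X^(2nU) * W^M` such compositions, and `δ ≤ 1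
/ (2 log W)` keeps each Hamming ball below `exp (O(U²))`. For `n ≤ U` the encoders also contribute
only `exp (O(U²))`. A positive fraction of all `W^(U²)` functions, with `W → ∞`, therefore forces `M
≥ (1 - ε) U²`: some encoders have distinct outputs on almost all message pairs
(`exists_encoders_of_le_feasibleFraction`).

For such encoders, subadditivity of entropy bounds the message entropy by the sum of the letter
entropies, both unconditionally and given either message (`le_sum_negMulLog_of_injOn`). Averaging
over time gives a point of the convex hull `entropyRegion g`. This hull is compact and independent
of `U`, so a maximiser of `symmetricRate` on it serves all `U` at once.

For `n ≥ U` the bound `log U ≤ n s` is immediate once the maximal rate `s` is positive. It is: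
otherwise `g` ignores one of its inputs, and the outputs, determined by one message, allow too few
functions. -/

namespace MACComputation

open Finset

/-! ### Counting feasible target functions -/

/-- The number of words at Hamming distance at most `k` from a given word. -/
lemma card_hammingBall_le {A : Type*} [Fintype A] [DecidableEq A] {W : ℕ} (hW : 1 ≤ W)
    (v₀ : A → Fin W) (k : ℝ) :
    ((univ.filter fun v : A → Fin W =>
        ((univ.filter fun a => v a ≠ v₀ a).card : ℝ) ≤ k).card : ℝ) ≤
      2 ^ Fintype.card A * (W : ℝ) ^ k := by
  have hW0 : (0 : ℝ) < W := by exact_mod_cast hW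
  have hW1 : (1 : ℝ) ≤ W := by exact_mod_cast hW
  -- Weigh `v` by `W⁻¹` for each disagreement with `v₀`. The total weight factors over coordinates,
  -- each contributing at most 2, while a word in the ball weighs at least `W^(-k)`.
  have hsum : ∑ v : A → Fin W, ∏ a, (if v a = v₀ a then (1 : ℝ) else (W : ℝ)⁻¹) ≤
      2 ^ Fintype.card A := by
    have h := Finset.prod_univ_sum (fun _ : A => (univ : Finset (Fin W)))
      (fun a w => if w = v₀ a then (1 : ℝ) else (W : ℝ)⁻¹)
    rw [Fintype.piFinset_univ] at h
    rw [← h]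
    calc ∏ a, ∑ w : Fin W, (if w = v₀ a then (1 : ℝ) else (W : ℝ)⁻¹)
        ≤ ∏ _a : A, (2 : ℝ) := by
          refine Finset.prod_le_prod (fun a _ => Finset.sum_nonneg fun w _ => ?_) fun a _ => ?_
          · split_ifs <;> positivity
          · calc ∑ w : Fin W, (if w = v₀ a then (1 : ℝ) else (W : ℝ)⁻¹)
                ≤ ∑ w : Fin W, ((if w = v₀ a then (1 : ℝ) else 0) + (W : ℝ)⁻¹) := by
                  refine Finset.sum_le_sum fun w _ => ?_
                  have : (0 : ℝ) ≤ (W : ℝ)⁻¹ := by positivity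
                  split_ifs <;> linarith
              _ = 2 := by
                  rw [Finset.sum_add_distrib]
                  simp only [Finset.sum_ite_eq', Finset.mem_univ, if_true, Finset.sum_const,
                    Finset.card_univ, Fintype.card_fin, nsmul_eq_mul]
                  rw [mul_inv_cancel₀ hW0.ne']
                  norm_num
      _ = 2 ^ Fintype.card A := by simp
  have hlow : ((univ.filter fun v : A → Fin W =>
        ((univ.filter fun a => v a ≠ v₀ a).card : ℝ) ≤ k).card : ℝ) * (W : ℝ) ^ (-k) ≤
      ∑ v : A → Fin W, ∏ a, (if v a = v₀ a then (1 : ℝ) else (W : ℝ)⁻¹) := by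
    rw [← nsmul_eq_mul, ← Finset.sum_const]
    refine (Finset.sum_le_sum fun v hv => ?_).trans
      (Finset.sum_le_univ_sum_of_nonneg fun v => Finset.prod_nonneg fun a _ => ?_)
    · rw [Finset.prod_ite]
      simp only [Finset.prod_const_one, one_mul, Finset.prod_const]
      rw [inv_pow, ← Real.rpow_natCast, ← Real.rpow_neg hW0.le]
      exact Real.rpow_le_rpow_of_exponent_le hW1 (neg_le_neg (Finset.mem_filter.1 hv).2)
    · split_ifs <;> positivity
  have := hlow.trans hsum
  rwa [Real.rpow_neg hW0.le, ← div_eq_mul_inv, div_le_iff₀ (by positivity)] at this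

/-- The number of words that are close to a word that factors through one of the maps `s t`. -/
lemma card_near_factor_le {A T Z : Type} [Fintype A] [DecidableEq A] [Fintype T]
    [DecidableEq Z] {W : ℕ} (hW : 1 ≤ W) (s : T → A → Z) (k M : ℝ)
    (hM : ∀ t, ((univ.image (s t)).card : ℝ) ≤ M) (F : Set (A → Fin W))
    (hF : ∀ v ∈ F, ∃ t, ∃ φ : Z → Fin W,
      ((univ.filter fun a => v a ≠ φ (s t a)).card : ℝ) ≤ k) :
    (Nat.card F : ℝ) ≤
      Fintype.card T * ((W : ℝ) ^ M * (2 ^ Fintype.card A * (W : ℝ) ^ k)) := by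
  classical
  have hW1 : (1 : ℝ) ≤ W := by exact_mod_cast hW
  -- Only the values of `φ` on the range of `s t` matter, so the exponent of `W` is the size of that
  -- range and not of `Z`.
  let B : (Σ t : T, ((univ.image (s t) : Finset Z) → Fin W)) → Finset (A → Fin W) := fun p =>
    univ.filter fun v => ((univ.filter fun a => v a ≠
      p.2 ⟨s p.1 a, Finset.mem_image_of_mem _ (mem_univ a)⟩).card : ℝ) ≤ k
  have hsub : F.toFinset ⊆ univ.biUnion B := by
    intro v hv
    obtain ⟨t, φ, h⟩ := hF v (Set.mem_toFinset.1 hv)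
    exact Finset.mem_biUnion.2 ⟨⟨t, fun z => φ z⟩, mem_univ _,
      Finset.mem_filter.2 ⟨mem_univ _, h⟩⟩
  have h1 : (F.toFinset.card : ℝ) ≤ ∑ p, ((B p).card : ℝ) := by
    exact_mod_cast (Finset.card_le_card hsub).trans Finset.card_biUnion_le
  have h2 : ∑ p, ((B p).card : ℝ) ≤
      ∑ _p : (Σ t : T, ((univ.image (s t) : Finset Z) → Fin W)),
        ((2 : ℝ) ^ Fintype.card A * (W : ℝ) ^ k) :=
    Finset.sum_le_sum fun p _ => card_hammingBall_le hW _ k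
  rw [Nat.card_eq_card_toFinset F]
  refine (h1.trans h2).trans ?_
  rw [Finset.sum_const, Finset.card_univ, nsmul_eq_mul, ← mul_assoc (Fintype.card T : ℝ)]
  refine mul_le_mul_of_nonneg_right (a := (2 : ℝ) ^ Fintype.card A * (W : ℝ) ^ k) ?_
    (by positivity)
  rw [Fintype.card_sigma]
  push_cast
  calc ∑ t, ((Fintype.card ((univ.image (s t) : Finset Z) → Fin W) : ℕ) : ℝ)
      ≤ ∑ _t : T, (W : ℝ) ^ M := by
        refine Finset.sum_le_sum fun t _ => ?_
        rw [Fintype.card_fun, Fintype.card_fin, Fintype.card_coe]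
        push_cast
        rw [← Real.rpow_natCast]
        exact Real.rpow_le_rpow_of_exponent_le hW1 (hM t)
    _ = _ := by rw [Finset.sum_const, Finset.card_univ, nsmul_eq_mul]

/-- If a fraction `c` of the target functions is feasible, and feasible target functions are close to
functions that factor through one of the maps `s t`, then the range of `s t` cannot be small. -/
lemma log_le_of_le_feasibleFraction {X Y : ℕ} (g : Channel X Y) {n U W : ℕ} {δ c : ℝ}
    (hU : 1 ≤ U) (hW : 2 ≤ W) (hδ : δ ≤ 1 / (2 * Real.log W)) (hc : 0 < c)
    (hfrac : c ≤ feasibleFraction g n U W δ) {T Z : Type} [Fintype T] [DecidableEq Z]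
    (s : T → Fin U × Fin U → Z) (M : ℝ) (hM : ∀ t, ((univ.image (s t)).card : ℝ) ≤ M)
    (hs : ∀ (f₁ f₂ : Fin U → Fin n → Fin X) (φ : (Fin n → Fin Y) → Fin W),
      ∃ t, ∃ ψ : Z → Fin W, ∀ u, φ (g.power n (f₁ u.1) (f₂ u.2)) = ψ (s t u)) :
    Real.log c + (U : ℝ) ^ 2 * Real.log W ≤
      Real.log (Fintype.card T) + M * Real.log W + (U : ℝ) ^ 2 * (Real.log 2 + 1 / 2) := by
  have hW0 : (0 : ℝ) < W := by exact_mod_cast (by omega : 0 < W)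
  have hU0 : (0 : ℝ) < U := by exact_mod_cast hU
  have hL : 0 < Real.log W := Real.log_pos (by exact_mod_cast (by omega : 1 < W))
  let e : TargetFunction U W ≃ (Fin U × Fin U → Fin W) := (Equiv.curry _ _ _).symm
  let F : Set (Fin U × Fin U → Fin W) := e '' {a | Feasible δ a (g.power n)}
  have hcardF : Nat.card {a : TargetFunction U W // Feasible δ a (g.power n)} = Nat.card F :=
    (Nat.card_image_of_injective e.injective _).symm
  have hF : ∀ v ∈ F, ∃ t, ∃ φ : Z → Fin W,
      ((univ.filter fun a => v a ≠ φ (s t a)).card : ℝ) ≤ δ * (U : ℝ) ^ 2 := by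
    rintro _ ⟨a, ⟨f₁, f₂, φ, h⟩, rfl⟩
    obtain ⟨t, ψ, hψ⟩ := hs f₁ f₂ φ
    refine ⟨t, ψ, ?_⟩
    rw [errorProb, div_le_iff₀ (by simp only [Fintype.card_fin]; positivity)] at h
    simp only [Fintype.card_fin, hψ] at h
    rw [sq]
    exact h
  have hcount := card_near_factor_le (by omega : 1 ≤ W) s (δ * (U : ℝ) ^ 2) M hM F hF
  rw [feasibleFraction, hcardF] at hfrac
  have htot : (Nat.card (TargetFunction U W) : ℝ) = (W : ℝ) ^ (U ^ 2) := by
    rw [Nat.card_congr e, Nat.card_eq_fintype_card]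
    simp [sq]
  rw [htot, le_div_iff₀ (by positivity)] at hfrac
  have hle := hfrac.trans hcount
  have hT : 0 < (Fintype.card T : ℝ) := by
    by_contra hT
    have hT' : (Fintype.card T : ℝ) = 0 := le_antisymm (not_lt.1 hT) (Nat.cast_nonneg _)
    rw [hT', zero_mul] at hle
    exact absurd hle (not_le.2 (by positivity))
  have hlog := Real.log_le_log (by positivity) hle
  rw [Real.log_mul hc.ne' (by positivity), Real.log_mul hT.ne' (by positivity),
    Real.log_mul (by positivity) (by positivity), Real.log_mul (by positivity) (by positivity),
    Real.log_rpow hW0, Real.log_rpow hW0, Real.log_pow, Real.log_pow] at hlog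
  simp only [Fintype.card_prod, Fintype.card_fin] at hlog
  push_cast at hlog
  -- This is where the threshold on `δ` enters: `W^(δ U²) ≤ exp (U² / 2)`.
  have hδL : δ * Real.log W ≤ 1 / 2 := by
    calc δ * Real.log W ≤ 1 / (2 * Real.log W) * Real.log W := by gcongr
      _ = 1 / 2 := by field_simp
  nlinarith [mul_le_mul_of_nonneg_left hδL (sq_nonneg (U : ℝ))]

/-! ### Subadditivity of entropy for nearly injective codes -/

/-- The entropies of the coordinates of a uniformly chosen word, when the words are distinct on `S`. -/
lemma le_sum_negMulLog_of_injOn {V I Y : Type*} [Fintype V] [Nonempty V] [Fintype I]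
    [DecidableEq I] [Fintype Y] [DecidableEq Y] (z : V → I → Y) (S : Finset V)
    (hS : Set.InjOn z S) :
    (S.card : ℝ) * Real.log (Fintype.card V) - (Fintype.card V - S.card) ≤
      Fintype.card V * ∑ i, ∑ y, Real.negMulLog
        ((univ.filter fun v => z v i = y).card / (Fintype.card V : ℝ)) := by
  classical
  set N : ℝ := (Fintype.card V : ℝ) with hN
  have hN0 : 0 < N := by rw [hN]; exact_mod_cast Fintype.card_pos
  let r : I → Y → ℝ := fun i y => (univ.filter fun v => z v i = y).card / N
  -- The product of the coordinate marginals; the sum of the coordinate entropies is the mean of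
  -- `-log q`. Injectivity on `S` bounds the `q`-mass of the words from `S` by 1.
  let q : (I → Y) → ℝ := fun w => ∏ i, r i (w i)
  have hr0 : ∀ i y, 0 ≤ r i y := fun i y => by positivity
  have hr1 : ∀ i, ∑ y, r i y = 1 := by
    intro i
    simp only [r]
    rw [← Finset.sum_div, div_eq_one_iff_eq hN0.ne', hN]
    exact_mod_cast (Finset.card_eq_sum_card_fiberwise
      (fun v _ => mem_univ (z v i)) : (univ : Finset V).card = _).symm
  have hrpos : ∀ v i, 0 < r i (z v i) := by
    intro v i
    refine div_pos ?_ hN0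
    exact_mod_cast Finset.card_pos.2 ⟨v, by simp⟩
  have hrle : ∀ i y, r i y ≤ 1 := fun i y =>
    (Finset.single_le_sum (fun y _ => hr0 i y) (mem_univ y)).trans_eq (hr1 i)
  have hqsum : ∑ w, q w = 1 := by
    have h := Finset.prod_univ_sum (fun _ : I => (univ : Finset Y)) r
    rw [Fintype.piFinset_univ] at h
    simp only [q]
    rw [← h]
    simp [hr1]
  have hqpos : ∀ v, 0 < q (z v) := fun v => Finset.prod_pos fun i _ => hrpos v i
  have hqle : ∀ v, q (z v) ≤ 1 := fun v =>
    Finset.prod_le_one (fun i _ => hr0 i _) fun i _ => hrle i _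
  have hqS : ∑ v ∈ S, q (z v) ≤ 1 := by
    rw [← Finset.sum_image (f := q) hS, ← hqsum]
    exact Finset.sum_le_univ_sum_of_nonneg fun w => Finset.prod_nonneg fun i _ => hr0 i _
  have hent : N * ∑ i, ∑ y, Real.negMulLog (r i y) = ∑ v, -Real.log (q (z v)) := by
    have h1 : ∀ v, -Real.log (q (z v)) = ∑ i, -Real.log (r i (z v i)) := by
      intro v
      simp only [q]
      rw [Real.log_prod fun i _ => (hrpos v i).ne', Finset.sum_neg_distrib]
    simp only [h1]
    rw [Finset.mul_sum, Finset.sum_comm]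
    refine Finset.sum_congr rfl fun i _ => ?_
    rw [Finset.mul_sum, ← Finset.sum_fiberwise_of_maps_to
      (fun v _ => mem_univ (z v i)) fun v => -Real.log (r i (z v i))]
    refine Finset.sum_congr rfl fun y _ => ?_
    have hconst : ∑ v with z v i = y, -Real.log (r i (z v i)) =
        ∑ v with z v i = y, -Real.log (r i y) :=
      Finset.sum_congr rfl fun v hv => by rw [(Finset.mem_filter.1 hv).2]
    rw [hconst, Finset.sum_const, nsmul_eq_mul, Real.negMulLog]
    have : N * r i y = (univ.filter fun v => z v i = y).card := by
      simp only [r]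
      field_simp
    rw [← this]
    ring
  change _ ≤ N * ∑ i, ∑ y, Real.negMulLog (r i y)
  rw [hent]
  have hlow : ∑ v ∈ S, -Real.log (q (z v)) ≤ ∑ v, -Real.log (q (z v)) :=
    Finset.sum_le_univ_sum_of_nonneg fun v => by
      have := Real.log_nonpos (hqpos v).le (hqle v)
      linarith
  refine le_trans ?_ hlow
  -- This is `log t ≤ t - 1` at `t = N * q (z v)`.
  have hterm : ∀ v ∈ S, Real.log N + 1 - N * q (z v) ≤ -Real.log (q (z v)) := by
    intro v _
    have h := Real.log_le_sub_one_of_pos (mul_pos hN0 (hqpos v))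
    rw [Real.log_mul hN0.ne' (hqpos v).ne'] at h
    linarith
  refine le_trans ?_ (Finset.sum_le_sum hterm)
  rw [Finset.sum_sub_distrib, Finset.sum_const, nsmul_eq_mul, ← Finset.mul_sum]
  nlinarith [mul_le_mul_of_nonneg_left hqS hN0.le]

/-! ### Compactness of convex hulls -/

/-- By Carathéodory, `finrank + 1` points suffice, so the hull is a continuous image of a simplex
times a power of `s`. Shorter combinations are padded with weight 0 at a fixed point `c`. -/
lemma isCompact_convexHull {E : Type*} [NormedAddCommGroup E] [NormedSpace ℝ E]
    [FiniteDimensional ℝ E] {s : Set E} (hs : IsCompact s) : IsCompact (convexHull ℝ s) := by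
  rcases s.eq_empty_or_nonempty with rfl | ⟨c, hc⟩
  · simp
  let J := Fin (Module.finrank ℝ E + 1)
  have himage : convexHull ℝ s = (fun wz : (J → ℝ) × (J → E) => ∑ j, wz.1 j • wz.2 j) ''
      (stdSimplex ℝ J ×ˢ Set.pi Set.univ fun _ => s) := by
    refine Set.Subset.antisymm (fun x hx => ?_) ?_
    · obtain ⟨ι, _, z, w, hz, hind, hw0, hw1, rfl⟩ := eq_pos_convex_span_of_mem_convexHull hx
      have hcard : Fintype.card ι ≤ Fintype.card J := by
        rw [Fintype.card_fin]
        exact hind.card_le_finrank_succ.trans (Nat.succ_le_succ (Submodule.finrank_le _))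
      obtain ⟨f⟩ := Function.Embedding.nonempty_of_card_le hcard
      have hout : ∀ j ∉ Set.range f, Function.extend f w 0 j = 0 := fun j hj => by
        rw [Function.extend_apply' _ _ _ (by simpa using hj), Pi.zero_apply]
      refine ⟨(Function.extend f w 0, Function.extend f z fun _ => c), ⟨⟨fun j => ?_, ?_⟩,
        fun j _ => ?_⟩, ?_⟩
      · by_cases hj : j ∈ Set.range f
        · obtain ⟨i, rfl⟩ := hj
          simpa only [f.injective.extend_apply] using (hw0 i).le
        · exact (hout j hj).ge
      · rw [← hw1]
        exact (Fintype.sum_of_injective f f.injective _ _ hout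
          fun i => (f.injective.extend_apply w 0 i).symm).symm
      · by_cases hj : j ∈ Set.range f
        · obtain ⟨i, rfl⟩ := hj
          simpa only [f.injective.extend_apply] using hz ⟨i, rfl⟩
        · dsimp only
          rwa [Function.extend_apply' _ _ _ (by simpa using hj)]
      · refine (Fintype.sum_of_injective f f.injective _ _ (fun j hj => ?_) fun i => ?_).symm
        · dsimp only
          rw [hout j hj, zero_smul]
        · simp only [f.injective.extend_apply]
    · rintro _ ⟨⟨w, z⟩, ⟨hw, hz⟩, rfl⟩
      exact (convex_convexHull ℝ s).sum_mem (fun j _ => hw.1 j) hw.2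
        fun j _ => subset_convexHull ℝ s (hz j trivial)
  rw [himage]
  exact ((isCompact_stdSimplex ℝ J).prod (isCompact_univ_pi fun _ => hs)).image (by fun_prop)

/-! ### Single-letter entropies and the time-sharing region -/

section Entropy

variable {X Y : ℕ}

/-- The entropy in nats of the output of `g` for independent inputs with mass functions `p`, `r`. -/
noncomputable def outputEntropy (g : Channel X Y) (p r : Fin X → ℝ) : ℝ :=
  ∑ y, Real.negMulLog (∑ x₁, ∑ x₂, if g x₁ x₂ = y then p x₁ * r x₂ else 0)

/-- The entropy in nats of the output of `g` given the first input. -/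
noncomputable def outputEntropyGivenLeft (g : Channel X Y) (p r : Fin X → ℝ) : ℝ :=
  ∑ x₁, p x₁ * ∑ y, Real.negMulLog (∑ x₂, if g x₁ x₂ = y then r x₂ else 0)

/-- The channel with its two inputs exchanged. -/
def Channel.swap (g : Channel X Y) : Channel X Y := fun x₁ x₂ => g x₂ x₁

lemma InputDistribution.entropyGivenQ_eq (P : InputDistribution X) (g : Channel X Y) :
    P.entropyGivenQ g =
      (∑ q, P.pQ q * outputEntropy g (P.p₁ q) (P.p₂ q)) / Real.log 2 := by
  rw [InputDistribution.entropyGivenQ, condEntropy, Finset.sum_div]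
  refine Finset.sum_congr rfl fun q _ => ?_
  have hq : prob P.joint (fun ω => ω.1 = q) = P.pQ q := by
    simp only [prob, InputDistribution.joint, Finset.sum_filter, Fintype.sum_prod_type]
    rw [Finset.sum_eq_single q (fun b _ hb => by simp [hb]) (by simp)]
    simp only [if_true, ← Finset.mul_sum, (P.p₂_mem q).2, mul_one, (P.p₁_mem q).2]
  have hy : ∀ y, prob P.joint (fun ω => g ω.2.1 ω.2.2 = y ∧ ω.1 = q) =
      P.pQ q * ∑ x₁, ∑ x₂, if g x₁ x₂ = y then P.p₁ q x₁ * P.p₂ q x₂ else 0 := by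
    intro y
    simp only [prob, InputDistribution.joint, Finset.sum_filter, Fintype.sum_prod_type]
    rw [Finset.sum_eq_single q (fun b _ hb => by simp [hb]) (by simp)]
    simp only [and_true, Finset.mul_sum, mul_ite, mul_zero, mul_assoc]
  simp only [hq, hy]
  -- For `P.pQ q = 0` the conditional probabilities are the default 0, but the outer factor kills
  -- both sides.
  rcases eq_or_ne (P.pQ q) 0 with h0 | h0
  · simp [h0]
  · simp only [mul_div_cancel_left₀ _ h0, outputEntropy, ← Finset.sum_div, mul_div_assoc]

lemma InputDistribution.entropyGivenX₁Q_eq (P : InputDistribution X) (g : Channel X Y) :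
    P.entropyGivenX₁Q g =
      (∑ q, P.pQ q * outputEntropyGivenLeft g (P.p₁ q) (P.p₂ q)) / Real.log 2 := by
  rw [InputDistribution.entropyGivenX₁Q, condEntropy, Fintype.sum_prod_type, Finset.sum_comm,
    Finset.sum_div]
  refine Finset.sum_congr rfl fun q _ => ?_
  rw [outputEntropyGivenLeft, Finset.mul_sum, Finset.sum_div]
  refine Finset.sum_congr rfl fun x _ => ?_
  have hq : prob P.joint (fun ω => (ω.2.1, ω.1) = (x, q)) = P.pQ q * P.p₁ q x := by
    simp only [prob, InputDistribution.joint, Finset.sum_filter, Fintype.sum_prod_type,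
      Prod.mk.injEq]
    rw [Finset.sum_eq_single q (fun b _ hb => by simp [hb]) (by simp),
      Finset.sum_eq_single x (fun b _ hb => by simp [hb]) (by simp)]
    simp only [and_self, if_true, ← Finset.mul_sum, (P.p₂_mem q).2, mul_one]
  have hy : ∀ y, prob P.joint (fun ω => g ω.2.1 ω.2.2 = y ∧ (ω.2.1, ω.1) = (x, q)) =
      P.pQ q * P.p₁ q x * ∑ x₂, if g x x₂ = y then P.p₂ q x₂ else 0 := by
    intro y
    simp only [prob, InputDistribution.joint, Finset.sum_filter, Fintype.sum_prod_type,
      Prod.mk.injEq]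
    rw [Finset.sum_eq_single q (fun b _ hb => by simp [hb]) (by simp),
      Finset.sum_eq_single x (fun b _ hb => by simp [hb]) (by simp)]
    simp only [and_self, and_true, Finset.mul_sum, mul_ite, mul_zero]
  simp only [hq, hy]
  rcases eq_or_ne (P.pQ q * P.p₁ q x) 0 with h0 | h0
  · rw [h0, ← mul_assoc, h0]
    simp
  · simp only [mul_div_cancel_left₀ _ h0, ← Finset.sum_div]
    simp only [mul_div_assoc, mul_assoc]

lemma InputDistribution.entropyGivenX₂Q_eq (P : InputDistribution X) (g : Channel X Y) :
    P.entropyGivenX₂Q g =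
      (∑ q, P.pQ q * outputEntropyGivenLeft g.swap (P.p₂ q) (P.p₁ q)) / Real.log 2 := by
  rw [InputDistribution.entropyGivenX₂Q, condEntropy, Fintype.sum_prod_type, Finset.sum_comm,
    Finset.sum_div]
  refine Finset.sum_congr rfl fun q _ => ?_
  rw [outputEntropyGivenLeft, Finset.mul_sum, Finset.sum_div]
  refine Finset.sum_congr rfl fun x _ => ?_
  have hq : prob P.joint (fun ω => (ω.2.2, ω.1) = (x, q)) = P.pQ q * P.p₂ q x := by
    simp only [prob, InputDistribution.joint, Finset.sum_filter, Fintype.sum_prod_type,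
      Prod.mk.injEq]
    rw [Finset.sum_eq_single q (fun b _ hb => by simp [hb]) (by simp), Finset.sum_comm,
      Finset.sum_eq_single x (fun b _ hb => by simp [hb]) (by simp)]
    simp only [and_self, if_true, ← Finset.mul_sum, ← Finset.sum_mul, (P.p₁_mem q).2, mul_one]
  have hy : ∀ y, prob P.joint (fun ω => g ω.2.1 ω.2.2 = y ∧ (ω.2.2, ω.1) = (x, q)) =
      P.pQ q * P.p₂ q x * ∑ x₁, if g.swap x x₁ = y then P.p₁ q x₁ else 0 := by
    intro y
    simp only [prob, InputDistribution.joint, Finset.sum_filter, Fintype.sum_prod_type,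
      Prod.mk.injEq]
    rw [Finset.sum_eq_single q (fun b _ hb => by simp [hb]) (by simp), Finset.sum_comm,
      Finset.sum_eq_single x (fun b _ hb => by simp [hb]) (by simp)]
    simp only [and_true]
    rw [Finset.mul_sum]
    refine Finset.sum_congr rfl fun x₁ _ => ?_
    by_cases h : g x₁ x = y
    · rw [if_pos h, if_pos (show g.swap x x₁ = y from h)]
      ring
    · rw [if_neg h, if_neg (show ¬g.swap x x₁ = y from h), mul_zero]
  simp only [hq, hy]
  rcases eq_or_ne (P.pQ q * P.p₂ q x) 0 with h0 | h0
  · rw [h0, ← mul_assoc, h0]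
    simp
  · simp only [mul_div_cancel_left₀ _ h0, ← Finset.sum_div]
    simp only [mul_div_assoc, mul_assoc]

/-- The three output entropies of `g` for independent inputs: unconditional, given the first input,
and given the second input. -/
noncomputable def entropyVector (g : Channel X Y) (pr : (Fin X → ℝ) × (Fin X → ℝ)) : ℝ × ℝ × ℝ :=
  (outputEntropy g pr.1 pr.2, outputEntropyGivenLeft g pr.1 pr.2,
    outputEntropyGivenLeft g.swap pr.2 pr.1)

lemma continuous_entropyVector (g : Channel X Y) : Continuous (entropyVector g) := by
  have h0 : Continuous fun pr : (Fin X → ℝ) × (Fin X → ℝ) => outputEntropy g pr.1 pr.2 := by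
    unfold outputEntropy
    refine continuous_finsetSum _ fun y _ => Real.continuous_negMulLog.comp <|
      continuous_finsetSum _ fun x₁ _ => continuous_finsetSum _ fun x₂ _ => ?_
    split_ifs <;> fun_prop
  have h1 : ∀ g : Channel X Y, Continuous fun pr : (Fin X → ℝ) × (Fin X → ℝ) =>
      outputEntropyGivenLeft g pr.1 pr.2 := by
    intro g
    unfold outputEntropyGivenLeft
    refine continuous_finsetSum _ fun x₁ _ => Continuous.mul (by fun_prop) <|
      continuous_finsetSum _ fun y _ => Real.continuous_negMulLog.comp <|
        continuous_finsetSum _ fun x₂ _ => ?_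
    split_ifs <;> fun_prop
  exact h0.prodMk ((h1 g).prodMk ((h1 g.swap).comp continuous_swap))

/-- The entropy vectors that are achieved with time sharing. -/
def entropyRegion (g : Channel X Y) : Set (ℝ × ℝ × ℝ) :=
  convexHull ℝ (entropyVector g '' (stdSimplex ℝ (Fin X) ×ˢ stdSimplex ℝ (Fin X)))

lemma isCompact_entropyRegion (g : Channel X Y) : IsCompact (entropyRegion g) :=
  isCompact_convexHull (((isCompact_stdSimplex ℝ (Fin X)).prod (isCompact_stdSimplex ℝ (Fin X))).image
    (continuous_entropyVector g))

/-- The index of the convex combination becomes the time-sharing variable `q`, since conditional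
entropies average over `q`. -/
lemma exists_inputDistribution_of_mem_entropyRegion (g : Channel X Y) {e : ℝ × ℝ × ℝ}
    (he : e ∈ entropyRegion g) : ∃ P : InputDistribution X,
      P.entropyGivenQ g = e.1 / Real.log 2 ∧ P.entropyGivenX₁Q g = e.2.1 / Real.log 2 ∧
        P.entropyGivenX₂Q g = e.2.2 / Real.log 2 := by
  obtain ⟨ι, _, w, z, hw0, hw1, hz, rfl⟩ := mem_convexHull_iff_exists_fintype.1 he
  choose pr hpr hprz using hz
  let ε := Fintype.equivFin ι
  let P : InputDistribution X :=
    { Q := Fintype.card ι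
      pQ := fun q => w (ε.symm q)
      p₁ := fun q => (pr (ε.symm q)).1
      p₂ := fun q => (pr (ε.symm q)).2
      pQ_mem := ⟨fun q => hw0 _, by rw [Equiv.sum_comp ε.symm w, hw1]⟩
      p₁_mem := fun q => (hpr _).1
      p₂_mem := fun q => (hpr _).2 }
  refine ⟨P, ?_, ?_, ?_⟩
  · rw [P.entropyGivenQ_eq, Prod.fst_sum]
    congr 1
    rw [← Equiv.sum_comp ε.symm]
    simp only [← hprz]
    rfl
  · rw [P.entropyGivenX₁Q_eq, Prod.snd_sum, Prod.fst_sum]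
    congr 1
    rw [← Equiv.sum_comp ε.symm]
    simp only [← hprz]
    rfl
  · rw [P.entropyGivenX₂Q_eq, Prod.snd_sum, Prod.snd_sum]
    congr 1
    rw [← Equiv.sum_comp ε.symm]
    simp only [← hprz]
    rfl

/-- The largest common rate of the two users, in nats per channel use, that the entropy vector `e`
allows. -/
noncomputable def symmetricRate (e : ℝ × ℝ × ℝ) : ℝ := min (e.1 / 2) (min e.2.1 e.2.2)

lemma exists_isMaxOn_symmetricRate (g : Channel X Y) (hne : (entropyRegion g).Nonempty) :
    ∃ e ∈ entropyRegion g, ∀ e' ∈ entropyRegion g, symmetricRate e' ≤ symmetricRate e := by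
  have hc : Continuous symmetricRate := by
    unfold symmetricRate
    fun_prop
  exact (isCompact_entropyRegion g).exists_isMaxOn hne hc.continuousOn

lemma sum_negMulLog_pos {p : Fin Y → ℝ} (hp : p ∈ stdSimplex ℝ (Fin Y)) {y₁ y₂ : Fin Y}
    (hy : y₁ ≠ y₂) (h₁ : 0 < p y₁) (h₂ : 0 < p y₂) : 0 < ∑ y, Real.negMulLog (p y) := by
  have hle : ∀ y, p y ≤ 1 := fun y =>
    (Finset.single_le_sum (fun y _ => hp.1 y) (mem_univ y)).trans_eq hp.2
  refine Finset.sum_pos' (fun y _ => Real.negMulLog_nonneg (hp.1 y) (hle y)) ⟨y₁, mem_univ _, ?_⟩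
  have hlt : p y₁ < 1 := by
    have h : ∑ y ∈ {y₁, y₂}, p y ≤ 1 :=
      (Finset.sum_le_univ_sum_of_nonneg hp.1).trans_eq hp.2
    rw [Finset.sum_pair hy] at h
    linarith
  rw [Real.negMulLog, neg_mul, neg_pos]
  exact mul_neg_of_pos_of_neg h₁ (Real.log_neg h₁ hlt)

lemma outputMass_mem_stdSimplex (h : Fin X → Fin Y) {r : Fin X → ℝ}
    (hr : r ∈ stdSimplex ℝ (Fin X)) :
    (fun y => ∑ x, if h x = y then r x else 0) ∈ stdSimplex ℝ (Fin Y) := by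
  refine ⟨fun y => Finset.sum_nonneg fun x _ => ?_, ?_⟩
  · split_ifs
    exacts [hr.1 x, le_rfl]
  · rw [Finset.sum_comm]
    simpa using hr.2

lemma outputMass_pos (h : Fin X → Fin Y) {r : Fin X → ℝ} (hr : ∀ x, 0 < r x) (x : Fin X) :
    0 < ∑ x', if h x' = h x then r x' else 0 := by
  refine Finset.sum_pos' (fun x' _ => ?_) ⟨x, mem_univ _, by simpa using hr x⟩
  split_ifs
  exacts [(hr x').le, le_rfl]

lemma outputEntropyGivenLeft_pos (g : Channel X Y) {p r : Fin X → ℝ} (hp : ∀ x, 0 < p x)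
    (hr : ∀ x, 0 < r x) (hr' : r ∈ stdSimplex ℝ (Fin X)) {x a b : Fin X} (h : g x a ≠ g x b) :
    0 < outputEntropyGivenLeft g p r := by
  have hmem := fun x' => outputMass_mem_stdSimplex (g x') hr'
  refine Finset.sum_pos' (fun x' _ => mul_nonneg (hp x').le ?_) ⟨x, mem_univ _, mul_pos (hp x) ?_⟩
  · refine Finset.sum_nonneg fun y _ => Real.negMulLog_nonneg ((hmem x').1 y) ?_
    exact (Finset.single_le_sum (fun y _ => (hmem x').1 y) (mem_univ y)).trans_eq (hmem x').2
  · exact sum_negMulLog_pos (hmem x) h (outputMass_pos (g x) hr a) (outputMass_pos (g x) hr b)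

lemma outputEntropy_pos (g : Channel X Y) {p r : Fin X → ℝ} (hp : ∀ x, 0 < p x)
    (hr : ∀ x, 0 < r x) (hp' : p ∈ stdSimplex ℝ (Fin X)) (hr' : r ∈ stdSimplex ℝ (Fin X))
    {x a b : Fin X} (h : g x a ≠ g x b) :
    0 < outputEntropy g p r := by
  have hnn : ∀ y, ∀ x₁, 0 ≤ ∑ x₂, if g x₁ x₂ = y then p x₁ * r x₂ else 0 := by
    intro y x₁
    refine Finset.sum_nonneg fun x₂ _ => ?_
    split_ifs
    exacts [mul_nonneg (hp x₁).le (hr x₂).le, le_rfl]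
  have hpos : ∀ a, 0 < ∑ x₁, ∑ x₂, if g x₁ x₂ = g x a then p x₁ * r x₂ else 0 := by
    intro a
    refine Finset.sum_pos' (fun x₁ _ => hnn _ x₁) ⟨x, mem_univ _, ?_⟩
    have := mul_pos (hp x) (outputMass_pos (g x) hr a)
    simpa only [Finset.mul_sum, mul_ite, mul_zero] using this
  refine sum_negMulLog_pos
    (p := fun y => ∑ x₁, ∑ x₂, if g x₁ x₂ = y then p x₁ * r x₂ else 0)
    ⟨fun y => Finset.sum_nonneg fun x₁ _ => hnn y x₁, ?_⟩ h (hpos a) (hpos b)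
  rw [Finset.sum_comm]
  rw [← hp'.2]
  refine Finset.sum_congr rfl fun x₁ _ => ?_
  rw [Finset.sum_comm]
  simp [← Finset.mul_sum, hr'.2]

/-- If `g` depends on both inputs, then some entropy vector allows both users a positive rate. -/
lemma exists_symmetricRate_pos (g : Channel X Y) {x₁ a₁ b₁ x₂ a₂ b₂ : Fin X}
    (h₁ : g x₁ a₁ ≠ g x₁ b₁) (h₂ : g a₂ x₂ ≠ g b₂ x₂) :
    ∃ e ∈ entropyRegion g, 0 < symmetricRate e := by
  have hX : (0 : ℝ) < X := by exact_mod_cast x₁.pos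
  -- Uniform inputs have full support, so any dependence of `g` on an input shows up as positive
  -- entropy.
  let p : Fin X → ℝ := fun _ => (X : ℝ)⁻¹
  have hp : ∀ x, 0 < p x := fun _ => by positivity
  have hp' : p ∈ stdSimplex ℝ (Fin X) := ⟨fun x => (hp x).le, by simp [p, hX.ne']⟩
  refine ⟨entropyVector g (p, p), subset_convexHull ℝ _ ⟨_, ⟨hp', hp'⟩, rfl⟩, ?_⟩
  refine lt_min (half_pos (outputEntropy_pos g hp hp hp' hp' h₁)) (lt_min ?_ ?_)
  · exact outputEntropyGivenLeft_pos g hp hp hp' h₁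
  · exact outputEntropyGivenLeft_pos g.swap (x := x₂) hp hp hp' h₂

end Entropy

/-! ### From codes to the entropy region -/

section Codes

variable {X Y : ℕ}

/-- The distribution of `f v` for uniform `v`. -/
noncomputable def empirical {V : Type*} [Fintype V] (f : V → Fin X) (x : Fin X) : ℝ :=
  (univ.filter fun v => f v = x).card / (Fintype.card V : ℝ)

lemma sum_empirical_mul {V : Type*} [Fintype V] (f : V → Fin X) (F : Fin X → ℝ) :
    ∑ x, empirical f x * F x = (∑ v, F (f v)) / (Fintype.card V : ℝ) := by
  rw [← Finset.sum_fiberwise_of_maps_to (fun v _ => mem_univ (f v)) fun v => F (f v),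
    Finset.sum_div]
  refine Finset.sum_congr rfl fun x _ => ?_
  have hconst : ∑ v with f v = x, F (f v) = ∑ v with f v = x, F x :=
    Finset.sum_congr rfl fun v hv => by rw [(Finset.mem_filter.1 hv).2]
  rw [hconst, Finset.sum_const, nsmul_eq_mul, empirical, div_mul_eq_mul_div]

lemma sum_ite_empirical {V : Type*} [Fintype V] (f : V → Fin X) (h : Fin X → Fin Y) (y : Fin Y) :
    (∑ x, if h x = y then empirical f x else 0) =
      (univ.filter fun v => h (f v) = y).card / (Fintype.card V : ℝ) := by
  have := sum_empirical_mul f fun x => if h x = y then 1 else 0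
  simpa using this

lemma empirical_mem_stdSimplex {V : Type*} [Fintype V] [Nonempty V] (f : V → Fin X) :
    empirical f ∈ stdSimplex ℝ (Fin X) := by
  refine ⟨fun x => div_nonneg (Nat.cast_nonneg _) (Nat.cast_nonneg _), ?_⟩
  have := sum_empirical_mul f fun _ => 1
  simpa using this

/-- Independent uniform messages make the two letters independent, so the pair count factors into
the empirical distributions. -/
lemma outputEntropy_empirical {U : ℕ} (g : Channel X Y) (f₁ f₂ : Fin U → Fin X) :
    outputEntropy g (empirical f₁) (empirical f₂) =
      ∑ y, Real.negMulLog ((univ.filter fun u : Fin U × Fin U => g (f₁ u.1) (f₂ u.2) = y).card /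
        (Fintype.card (Fin U × Fin U) : ℝ)) := by
  unfold outputEntropy
  refine Finset.sum_congr rfl fun y _ => congrArg _ ?_
  have h : ∀ x₁, (∑ x₂, if g x₁ x₂ = y then empirical f₁ x₁ * empirical f₂ x₂ else 0) =
      empirical f₁ x₁ * ((univ.filter fun v => g x₁ (f₂ v) = y).card / (U : ℝ)) := by
    intro x₁
    have := sum_ite_empirical f₂ (g x₁) y
    rw [Fintype.card_fin] at this
    rw [← this, Finset.mul_sum]
    simp only [mul_ite, mul_zero]
  simp only [h]
  rw [sum_empirical_mul f₁ fun x₁ => (univ.filter fun v => g x₁ (f₂ v) = y).card / (U : ℝ),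
    ← Finset.sum_div, div_div, Fintype.card_prod, Fintype.card_fin]
  push_cast
  congr 1
  simp only [Finset.card_filter, Fintype.sum_prod_type]
  push_cast
  rfl

lemma outputEntropyGivenLeft_empirical {U : ℕ} (g : Channel X Y) (f₁ f₂ : Fin U → Fin X) :
    outputEntropyGivenLeft g (empirical f₁) (empirical f₂) =
      (∑ u₁, ∑ y, Real.negMulLog ((univ.filter fun u₂ => g (f₁ u₁) (f₂ u₂) = y).card /
        (Fintype.card (Fin U) : ℝ))) / (Fintype.card (Fin U) : ℝ) := by
  unfold outputEntropyGivenLeft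
  simp only [sum_ite_empirical]
  exact sum_empirical_mul f₁ _

/-- The sum of the output entropies of the letters of a code with distinct outputs on `S`. -/
lemma le_sum_outputEntropy {U n : ℕ} (hU : 1 ≤ U) (g : Channel X Y)
    (f₁ f₂ : Fin U → Fin n → Fin X) (S : Finset (Fin U × Fin U))
    (hS : Set.InjOn (fun u : Fin U × Fin U => g.power n (f₁ u.1) (f₂ u.2)) S) :
    (S.card : ℝ) * (2 * Real.log U) - ((U : ℝ) ^ 2 - S.card) ≤
      (U : ℝ) ^ 2 * ∑ i, outputEntropy g (empirical fun u => f₁ u i) (empirical fun u => f₂ u i) := by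
  have : NeZero U := ⟨by omega⟩
  have h := le_sum_negMulLog_of_injOn (fun u : Fin U × Fin U => g.power n (f₁ u.1) (f₂ u.2)) S hS
  have hcard : (Fintype.card (Fin U × Fin U) : ℝ) = (U : ℝ) ^ 2 := by simp [sq]
  simp only [outputEntropy_empirical]
  rw [hcard] at h ⊢
  rw [Real.log_pow] at h
  exact_mod_cast h

/-- The sum of the output entropies given the first input of the letters of a code with distinct
outputs on `S`. -/
lemma le_sum_outputEntropyGivenLeft {U n : ℕ} (hU : 1 ≤ U) (g : Channel X Y)
    (f₁ f₂ : Fin U → Fin n → Fin X) (S : Finset (Fin U × Fin U))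
    (hS : Set.InjOn (fun u : Fin U × Fin U => g.power n (f₁ u.1) (f₂ u.2)) S) :
    (S.card : ℝ) * Real.log U - ((U : ℝ) ^ 2 - S.card) ≤
      (U : ℝ) ^ 2 * ∑ i, outputEntropyGivenLeft g
        (empirical fun u => f₁ u i) (empirical fun u => f₂ u i) := by
  have : NeZero U := ⟨by omega⟩
  have hU0 : (0 : ℝ) < U := by exact_mod_cast hU
  -- The slices of `S` at fixed `u₁`: the subadditivity bound applies to each, and their sizes add
  -- up to that of `S`.
  let R : Fin U → Finset (Fin U) := fun u₁ => univ.filter fun u₂ => (u₁, u₂) ∈ S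
  have hR : ∀ u₁, Set.InjOn (fun u₂ => g.power n (f₁ u₁) (f₂ u₂)) (R u₁) := by
    intro u₁ a ha b hb hab
    have ha' : (u₁, a) ∈ S := (Finset.mem_filter.1 ha).2
    have hb' : (u₁, b) ∈ S := (Finset.mem_filter.1 hb).2
    exact (Prod.mk.inj (hS ha' hb' hab)).2
  have hcard : ∑ u₁, ((R u₁).card : ℝ) = S.card := by
    have : S = univ.filter (fun u => u ∈ S) := by simp
    rw [this, Finset.card_filter, Fintype.sum_prod_type]
    simp only [R, Finset.card_filter]
    push_cast
    rfl
  have h := Finset.sum_le_sum fun u₁ (_ : u₁ ∈ univ) =>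
    le_sum_negMulLog_of_injOn (fun u₂ => g.power n (f₁ u₁) (f₂ u₂)) (R u₁) (hR u₁)
  rw [Finset.sum_sub_distrib, Finset.sum_sub_distrib, ← Finset.sum_mul, hcard,
    ← Finset.mul_sum] at h
  simp only [outputEntropyGivenLeft_empirical, ← Finset.sum_div]
  rw [Finset.sum_comm (s := univ) (t := univ) (γ := Fin n)]
  simp only [Fintype.card_fin, Finset.sum_const, Finset.card_univ, nsmul_eq_mul] at h ⊢
  refine le_trans (le_of_eq ?_) (h.trans (le_of_eq ?_))
  · ring
  · simp only [Channel.power]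
    field_simp
    rfl

/-- A code over `n` uses of `g` with distinct outputs on `S` bounds the maximal symmetric rate. -/
lemma le_mul_symmetricRate {U n : ℕ} (hU : 1 ≤ U) (g : Channel X Y) {s : ℝ}
    (hs : ∀ e ∈ entropyRegion g, symmetricRate e ≤ s)
    (f₁ f₂ : Fin U → Fin n → Fin X) (S : Finset (Fin U × Fin U))
    (hS : Set.InjOn (fun u : Fin U × Fin U => g.power n (f₁ u.1) (f₂ u.2)) S) :
    (S.card : ℝ) * Real.log U - ((U : ℝ) ^ 2 - S.card) ≤ (U : ℝ) ^ 2 * (n * s) := by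
  have : NeZero U := ⟨by omega⟩
  have hU0 : (0 : ℝ) < U := by exact_mod_cast hU
  -- Makes the defect `U² - |S|` nonnegative, so that half of the bound `h₀` is still at least `c`.
  have hcardS : (S.card : ℝ) ≤ (U : ℝ) ^ 2 := by
    have := Finset.card_le_univ S
    rw [Fintype.card_prod, Fintype.card_fin, ← sq] at this
    exact_mod_cast this
  have h₀ := le_sum_outputEntropy hU g f₁ f₂ S hS
  have h₁ := le_sum_outputEntropyGivenLeft hU g f₁ f₂ S hS
  have h₂ := le_sum_outputEntropyGivenLeft hU g.swap f₂ f₁ (S.map (Equiv.prodComm _ _).toEmbedding)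
    (by
      intro a ha b hb hab
      simp only [Finset.coe_map, Set.mem_image, Finset.mem_coe] at ha hb
      obtain ⟨a, ha, rfl⟩ := ha
      obtain ⟨b, hb, rfl⟩ := hb
      exact congrArg _ (hS ha hb hab))
  rw [Finset.card_map] at h₂
  set c := (S.card : ℝ) * Real.log U - ((U : ℝ) ^ 2 - S.card) with hc
  rcases Nat.eq_zero_or_pos n with rfl | hn
  · simpa using h₁
  have hn0 : (0 : ℝ) < n := by exact_mod_cast hn
  let E : Fin n → ℝ × ℝ × ℝ := fun i =>
    entropyVector g (empirical fun u => f₁ u i, empirical fun u => f₂ u i)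
  -- Time sharing uniformly over the `n` letters.
  have hmem : ∑ i, (n : ℝ)⁻¹ • E i ∈ entropyRegion g := by
    refine (convex_convexHull ℝ _).sum_mem (fun _ _ => by positivity) (by simp [hn0.ne'])
      fun i _ => subset_convexHull ℝ _ ⟨_, ⟨?_, ?_⟩, rfl⟩ <;>
    exact empirical_mem_stdSimplex _
  have hr := hs _ hmem
  have hlow : c / ((U : ℝ) ^ 2 * n) ≤ symmetricRate (∑ i, (n : ℝ)⁻¹ • E i) := by
    rw [← Finset.smul_sum]
    refine le_min ?_ (le_min ?_ ?_)
    · rw [Prod.smul_fst, Prod.fst_sum, smul_eq_mul, div_le_iff₀ (by positivity)]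
      simp only [E, entropyVector]
      field_simp
      linarith
    · rw [Prod.smul_snd, Prod.smul_fst, Prod.snd_sum, Prod.fst_sum, smul_eq_mul,
        div_le_iff₀ (by positivity)]
      simp only [E, entropyVector]
      field_simp
      linarith
    · rw [Prod.smul_snd, Prod.smul_snd, Prod.snd_sum, Prod.snd_sum, smul_eq_mul,
        div_le_iff₀ (by positivity)]
      simp only [E, entropyVector]
      field_simp
      linarith
  have := hlow.trans hr
  rw [div_le_iff₀ (by positivity)] at this
  linarith

end Codes

/-! ### Asymptotics in the number of messages -/

section Asymptotics

variable {X Y : ℕ}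

/-- If many target functions are feasible, then some encoders have many distinct channel outputs. -/
lemma exists_encoders_of_le_feasibleFraction (g : Channel X Y) {n U W : ℕ} {δ c ε : ℝ}
    (hU : 1 ≤ U) (hW : 2 ≤ W) (hδ : δ ≤ 1 / (2 * Real.log W)) (hc : 0 < c)
    (hfrac : c ≤ feasibleFraction g n U W δ) (hn : n ≤ U)
    (hε : 2 * Real.log X + Real.log 2 + 1 / 2 + |Real.log c| < ε * Real.log W) :
    ∃ (f₁ f₂ : Fin U → Fin n → Fin X) (S : Finset (Fin U × Fin U)),
      Set.InjOn (fun u : Fin U × Fin U => g.power n (f₁ u.1) (f₂ u.2)) S ∧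
        (1 - ε) * (U : ℝ) ^ 2 ≤ S.card := by
  by_contra! hcon
  have hU0 : (1 : ℝ) ≤ U := by exact_mod_cast hU
  have hX0 : 0 ≤ Real.log X := Real.log_natCast_nonneg X
  let s : (Fin U → Fin n → Fin X) × (Fin U → Fin n → Fin X) →
      Fin U × Fin U → Fin n → Fin Y := fun t u => g.power n (t.1 u.1) (t.2 u.2)
  have hM : ∀ t, ((univ.image (s t)).card : ℝ) ≤ (1 - ε) * (U : ℝ) ^ 2 := by
    intro t
    -- One message pair is kept for each output value.
    obtain ⟨S', -, hS'⟩ := Set.exists_subset_bijOn Set.univ (s t)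
    classical
    have hinj : Set.InjOn (s t) S'.toFinset := by simpa using hS'.injOn
    have himage : S'.toFinset.image (s t) = univ.image (s t) := by
      apply Finset.coe_injective
      simpa using hS'.image_eq
    rw [← himage, Finset.card_image_of_injOn hinj]
    exact (hcon t.1 t.2 _ hinj).le
  have h := log_le_of_le_feasibleFraction g hU hW hδ hc hfrac s _ hM
    fun f₁ f₂ φ => ⟨(f₁, f₂), φ, fun _ => rfl⟩
  have hT : (Fintype.card ((Fin U → Fin n → Fin X) × (Fin U → Fin n → Fin X)) : ℝ) =
      (((X : ℝ) ^ n) ^ U) ^ 2 := by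
    simp [sq]
  rw [hT, Real.log_pow, Real.log_pow, Real.log_pow] at h
  have hnU : (U : ℝ) * n * Real.log X ≤ (U : ℝ) ^ 2 * Real.log X := by
    rw [sq]
    gcongr
  have hlogc : -((U : ℝ) ^ 2 * |Real.log c|) ≤ Real.log c := by
    have h1 := neg_abs_le (Real.log c)
    have h2 : |Real.log c| ≤ (U : ℝ) ^ 2 * |Real.log c| :=
      le_mul_of_one_le_left (abs_nonneg _) (one_le_pow₀ hU0)
    linarith
  have hmul := mul_lt_mul_of_pos_left hε (by positivity : (0 : ℝ) < (U : ℝ) ^ 2)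
  push_cast at h
  linarith

/-- Few target functions are feasible if the channel output can be computed from one message. -/
lemma feasibleFraction_lt_of_factor (g : Channel X Y) {n U W : ℕ} {δ c : ℝ}
    (hU : 2 ≤ U) (hW : 2 ≤ W) (hδ : δ ≤ 1 / (2 * Real.log W)) (hc : 0 < c)
    (hlarge : 2 * (Real.log 2 + 1 / 2 + |Real.log c|) < Real.log W)
    (π : Fin U × Fin U → Fin U)
    (hπ : ∀ (f₁ f₂ : Fin U → Fin n → Fin X), ∃ h : Fin U → Fin n → Fin Y,
      ∀ u, g.power n (f₁ u.1) (f₂ u.2) = h (π u)) :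
    feasibleFraction g n U W δ < c := by
  by_contra! hfrac
  have hU0 : (2 : ℝ) ≤ U := by exact_mod_cast hU
  -- The encoders are absorbed into `ψ`, so the index type is `Unit` and no bound on `n` is needed.
  have h := log_le_of_le_feasibleFraction g (by omega) hW hδ hc hfrac (fun _ : Unit => π) U
    (fun _ => by
      have := Finset.card_le_univ (univ.image π)
      rw [Fintype.card_fin] at this
      exact_mod_cast this)
    fun f₁ f₂ φ => by
      obtain ⟨h, hh⟩ := hπ f₁ f₂
      exact ⟨(), fun u => φ (h u), fun u => by rw [hh]⟩
  rw [Fintype.card_unit, Nat.cast_one, Real.log_one] at h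
  have hlogc : -((U : ℝ) ^ 2 * |Real.log c|) ≤ Real.log c := by
    have h1 := neg_abs_le (Real.log c)
    have h2 : |Real.log c| ≤ (U : ℝ) ^ 2 * |Real.log c| :=
      le_mul_of_one_le_left (abs_nonneg _) (one_le_pow₀ (by linarith))
    linarith
  have hL : 0 ≤ Real.log W := Real.log_natCast_nonneg W
  have hUL : (U : ℝ) * Real.log W ≤ (U : ℝ) ^ 2 / 2 * Real.log W := by
    refine mul_le_mul_of_nonneg_right ?_ hL
    nlinarith
  have hmul := mul_lt_mul_of_pos_left hlarge (by positivity : (0 : ℝ) < (U : ℝ) ^ 2)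
  linarith

lemma eventually_log_le_mul_symmetricRate (g : Channel X Y) {W n : ℕ → ℕ} {δ : ℕ → ℝ} {c s : ℝ}
    (hW : Tendsto W atTop atTop)
    (hδ : ∀ᶠ U in atTop, δ U ≤ 1 / (2 * Real.log (W U : ℝ))) (hc : 0 < c)
    (hfrac : ∀ᶠ U in atTop, c ≤ feasibleFraction g (n U) U (W U) (δ U)) (hs0 : 0 < s)
    (hs : ∀ e ∈ entropyRegion g, symmetricRate e ≤ s) {η : ℝ} (hη : 0 < η) :
    ∀ᶠ U : ℕ in atTop, (1 - η) * Real.log U ≤ n U * s := by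
  have hlogW : Tendsto (fun U => η / 2 * Real.log (W U)) atTop atTop :=
    (Real.tendsto_log_atTop.comp (tendsto_natCast_atTop_atTop.comp hW)).const_mul_atTop
      (half_pos hη)
  have hlogU : Tendsto (fun U : ℕ => Real.log U) atTop atTop :=
    Real.tendsto_log_atTop.comp tendsto_natCast_atTop_atTop
  have hlogs : ∀ᶠ U : ℕ in atTop, Real.log U ≤ s * U := by
    filter_upwards [(Real.isLittleO_log_id_atTop.comp_tendsto
      (tendsto_natCast_atTop_atTop (R := ℝ))).bound hs0] with U hU
    simpa using (le_abs_self _).trans hU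
  filter_upwards [hδ, hfrac, eventually_ge_atTop 1, hW.eventually_ge_atTop 2,
    hlogW.eventually_gt_atTop (2 * Real.log X + Real.log 2 + 1 / 2 + |Real.log c|),
    hlogU.eventually_ge_atTop 1, hlogs] with U hδU hfracU hU hWU hlarge hlog hlogsU
  have hU0 : (0 : ℝ) < U := by exact_mod_cast hU
  rcases le_total (n U) U with hn | hn
  · obtain ⟨f₁, f₂, S, hS, hcard⟩ :=
      exists_encoders_of_le_feasibleFraction g hU hWU hδU hc hfracU hn hlarge
    have h := le_mul_symmetricRate hU g hs f₁ f₂ S hS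
    -- With `ε = η / 2`, the loss `η / 2` is absorbed because `log U ≥ 1`.
    have h1 := mul_le_mul_of_nonneg_right hcard (by linarith : 0 ≤ Real.log U + 1)
    have h2 : (U : ℝ) ^ 2 * ((1 - η / 2) * Real.log U - η / 2) ≤ (U : ℝ) ^ 2 * (n U * s) := by
      linarith
    have h3 := le_of_mul_le_mul_left h2 (by positivity)
    nlinarith
  · have hn' : (U : ℝ) ≤ n U := by exact_mod_cast hn
    have h1 := mul_le_mul_of_nonneg_right hn' hs0.le
    nlinarith

/-- If `g` depends on both inputs, uniform inputs have positive rate. If not, the output is a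
function of one message, which contradicts the feasible fraction whatever `n` is. -/
lemma symmetricRate_pos_of_le_feasibleFraction (g : Channel X Y) {W n : ℕ → ℕ} {δ : ℕ → ℝ}
    {c : ℝ} (hW : Tendsto W atTop atTop)
    (hδ : ∀ᶠ U in atTop, δ U ≤ 1 / (2 * Real.log (W U : ℝ))) (hc : 0 < c)
    (hfrac : ∀ᶠ U in atTop, c ≤ feasibleFraction g (n U) U (W U) (δ U)) :
    ∃ e ∈ entropyRegion g, 0 < symmetricRate e := by
  by_contra hcon
  have hlogW : Tendsto (fun U => Real.log (W U)) atTop atTop :=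
    Real.tendsto_log_atTop.comp (tendsto_natCast_atTop_atTop.comp hW)
  obtain ⟨U, hδU, hfracU, hU, hWU, hlarge⟩ := (hδ.and (hfrac.and ((eventually_ge_atTop 2).and
    ((hW.eventually_ge_atTop 2).and
      (hlogW.eventually_gt_atTop (2 * (Real.log 2 + 1 / 2 + |Real.log c|))))))).exists
  have : NeZero U := ⟨by omega⟩
  refine hfracU.not_gt ?_
  by_cases h₁ : ∀ x a b, g x a = g x b
  · refine feasibleFraction_lt_of_factor g hU hWU hδU hc hlarge Prod.fst fun f₁ f₂ =>
      ⟨fun u i => g (f₁ u i) (f₂ 0 i), fun u => funext fun i => h₁ _ _ _⟩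
  by_cases h₂ : ∀ x a b, g a x = g b x
  · refine feasibleFraction_lt_of_factor g hU hWU hδU hc hlarge Prod.snd fun f₁ f₂ =>
      ⟨fun u i => g (f₁ 0 i) (f₂ u i), fun u => funext fun i => h₂ _ _ _⟩
  push Not at h₁ h₂
  obtain ⟨x₁, a₁, b₁, h₁⟩ := h₁
  obtain ⟨x₂, a₂, b₂, h₂⟩ := h₂
  exact absurd (exists_symmetricRate_pos g h₁ h₂) hcon

lemma powDotLe_two_rpow {a s e : ℝ} {n : ℕ → ℕ} (ha : 0 < a) (hae : a * s ≤ e)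
    (hn : ∀ η : ℝ, 0 < η → ∀ᶠ U : ℕ in atTop, (1 - η) * Real.log U ≤ n U * s) :
    PowDotLe a fun U => (2 : ℝ) ^ ((n U : ℝ) * (e / Real.log 2)) := by
  refine le_of_forall_lt fun r hr => ?_
  obtain ⟨b, hrb, hba⟩ := EReal.lt_iff_exists_real_btwn.1 hr
  refine hrb.trans_le (le_liminf_of_le (by isBoundedDefault) ?_)
  have hba' : b < a := by exact_mod_cast hba
  -- This `η` makes `1 - η = b / a`.
  filter_upwards [hn ((a - b) / a) (div_pos (by linarith) ha), eventually_ge_atTop 2] with U hU hU2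
  have hlogU : 0 < Real.log U := Real.log_pos (by exact_mod_cast hU2)
  have hlog2 : 0 < Real.log 2 := Real.log_pos (by norm_num)
  have hη : 1 - (a - b) / a = b / a := by
    field_simp
    ring
  rw [hη, div_mul_eq_mul_div, div_le_iff₀ ha] at hU
  rw [EReal.coe_le_coe_iff, le_div_iff₀ hlogU, Real.log_rpow (by norm_num)]
  calc b * Real.log U ≤ n U * s * a := hU
    _ = n U * (a * s) := by ring
    _ ≤ n U * e := by gcongr
    _ = n U * (e / Real.log 2) * Real.log 2 := by field_simp

end Asymptotics

end MACComputation

theorem theorem4 (X Y : ℕ) (g : MACComputation.Channel X Y)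
    (W n : ℕ → ℕ) (δ : ℕ → ℝ)
    (hW : Tendsto W atTop atTop)
    (hWU : ∀ᶠ U in atTop, W U ≤ U ^ 2)
    (hδ : ∀ᶠ U in atTop, 0 < δ U ∧ δ U ≤ 1 / (2 * Real.log (W U : ℝ)))
    (hfrac : ∃ c : ℝ, 0 < c ∧
      ∀ᶠ U in atTop, c ≤ MACComputation.feasibleFraction g (n U) U (W U) (δ U)) :
    ∃ P : MACComputation.InputDistribution X,
      MACComputation.PowDotLe 2 (fun U => (2 : ℝ) ^ ((n U : ℝ) * P.entropyGivenQ g)) ∧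
      MACComputation.PowDotLe 1 (fun U => (2 : ℝ) ^ ((n U : ℝ) * P.entropyGivenX₁Q g)) ∧
      MACComputation.PowDotLe 1 (fun U => (2 : ℝ) ^ ((n U : ℝ) * P.entropyGivenX₂Q g)) := by
  open MACComputation in
  obtain ⟨c, hc, hfrac⟩ := hfrac
  have hδ' := hδ.mono fun _ h => h.2
  obtain ⟨e₀, he₀, hpos⟩ := symmetricRate_pos_of_le_feasibleFraction g hW hδ' hc hfrac
  obtain ⟨e, he, hmax⟩ := exists_isMaxOn_symmetricRate g ⟨e₀, he₀⟩
  have hbound := fun η (hη : 0 < η) => eventually_log_le_mul_symmetricRate g hW hδ' hc hfrac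
    (hpos.trans_le (hmax e₀ he₀)) hmax hη
  -- The maximiser `e` is a point of a region determined by `g` alone, so `P` does not vary with
  -- `U`.
  obtain ⟨P, h₀, h₁, h₂⟩ := exists_inputDistribution_of_mem_entropyRegion g he
  refine ⟨P, ?_, ?_, ?_⟩
  · rw [h₀]
    refine powDotLe_two_rpow two_pos ?_ hbound
    have h : symmetricRate e ≤ e.1 / 2 := min_le_left _ _
    linarith
  · rw [h₁]
    refine powDotLe_two_rpow one_pos ?_ hbound
    rw [one_mul]
    exact (min_le_right _ _).trans (min_le_left _ _)
  · rw [h₂]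
    refine powDotLe_two_rpow one_pos ?_ hbound
    rw [one_mul]
    exact (min_le_right _ _).trans (min_le_right _ _)
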